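/- Let $\mathcal D=\{(\rho,\theta):\rho\ge 0,\ \theta\in\mathbb R\}$ be the cone of infinite angle with the flat metric $d\rho^2+\rho^2d\theta^2$, all points $(0,\theta)$ being identified to one point $\mathcal O$ (the logarithmic singularity), and let $\rho_0>0$ and $\mathcal N=\{(\rho,\theta)\in\mathcal D:\rho\le\rho_0\}$. For a set $S\subset\mathcal N\setminus\{\mathcal O\}$, a solution of the minimal surface equation on $S$ is a continuous function $v:S\to\mathbb R$ which, in the interior of $S$, is of class $C^2$ and satisfies, in local flat coordinates, $$\operatorname{Div}\Bigl(\frac{\nabla v}{\sqrt{1+|\nabla v|^2}}\Bigr)=0 .\qquad\text{(MSE)}$$ (1) For every $\varepsilon>0$ there is $d\in(0,\rho_0)$, depending only on $\varepsilon$ and $\rho_0$, such that for every $\alpha\in\mathbb R$ and every solution $v$ of (MSE) on $\{0<\rho\le\rho_0,\ \alpha-\pi<\theta<\alpha+\pi\}$, all the following suprema and infima are finite and $$\sup_{0<\rho\le\rho_0}v(\rho,\alpha)<\sup_{[d,\rho_0]\times[\alpha-3\pi/4,\,\alpha+3\pi/4]}v(\rho,\theta)+\varepsilon,$$ $$\inf_{0<\rho\le\rho_0}v(\rho,\alpha)>\inf_{[d,\rho_0]\times[\alpha-3\pi/4,\,\alpha+3\pi/4]}v(\rho,\theta)-\varepsilon.$$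 (2) Consequently solutions are bounded near the singularity in every sector: if $\theta_1\le\theta_2$ and $v$ is a solution of (MSE) on $\{0<\rho\le\rho_0,\ \theta_1-\pi<\theta<\theta_2+\pi\}$ (in particular, if $v$ is a solution on all of $\mathcal N\setminus\{\mathcal O\}$), then $v$ is bounded on $(0,\rho_0]\times[\theta_1,\theta_2]$. -/

import Mathlib

open Real Set Filter Topology

noncomputable section

/-- The partial derivative `∂u/∂x` of a function on the plane. -/
def partialX (u : ℝ × ℝ → ℝ) (z : ℝ × ℝ) : ℝ := fderiv ℝ u z (1, 0)

/-- The partial derivative `∂u/∂y` of a function on the plane. -/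
def partialY (u : ℝ × ℝ → ℝ) (z : ℝ × ℝ) : ℝ := fderiv ℝ u z (0, 1)

/-- `W = √(1 + |∇u|²)`. -/
def areaDensity (u : ℝ × ℝ → ℝ) (z : ℝ × ℝ) : ℝ :=
  √(1 + (partialX u z ^ 2 + partialY u z ^ 2))

/-- `Div (∇u / W)`, the left-hand side of the minimal surface equation. -/
def minimalSurfaceOperator (u : ℝ × ℝ → ℝ) (z : ℝ × ℝ) : ℝ :=
  partialX (fun w => partialX u w / areaDensity u w) z +
    partialY (fun w => partialY u w / areaDensity u w) z

/-- `u` is a classical (`C²`) solution of the minimal surface equation on the open planar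
set `U`. -/
def SolvesMSEOnPlane (u : ℝ × ℝ → ℝ) (U : Set (ℝ × ℝ)) : Prop :=
  IsOpen U ∧ ContDiffOn ℝ 2 u U ∧ ∀ z ∈ U, minimalSurfaceOperator u z = 0

/-- Points of the infinite-angle cone minus its vertex are given by their polar coordinates
`(ρ, θ)`, `ρ > 0`, `θ ∈ ℝ`, where different values of `θ` give different points. For the flat
metric `dρ² + ρ² dθ²`, this map is a local isometry to the Euclidean plane. -/
def develop (p : ℝ × ℝ) : ℝ × ℝ := (p.1 * cos p.2, p.1 * sin p.2)

/-- The part `{0 < ρ ≤ ρ₀, a < θ < b}` (in polar coordinates) of the neighborhood of radius `ρ₀`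
of the vertex. -/
def coneSector (ρ₀ a b : ℝ) : Set (ℝ × ℝ) := Ioc 0 ρ₀ ×ˢ Ioo a b

/-- `v`, a function of the polar coordinates `(ρ, θ)`, is a solution of the minimal surface
equation on the set `S` of the infinite-angle cone minus its vertex: it is continuous on `S`,
and near every interior point of `S` it is, read in the flat coordinates given by `develop`,
a classical solution of the equation on a planar open set. -/
def SolvesMSEOnCone (v : ℝ × ℝ → ℝ) (S : Set (ℝ × ℝ)) : Prop :=
  ContinuousOn v S ∧
    ∀ p ∈ interior S, ∃ (u : ℝ × ℝ → ℝ) (U : Set (ℝ × ℝ)),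
      develop p ∈ U ∧ SolvesMSEOnPlane u U ∧ v =ᶠ[𝓝 p] u ∘ develop

/-- The ray `{0 < ρ ≤ ρ₀, θ = α}`. -/
def coneRay (ρ₀ α : ℝ) : Set (ℝ × ℝ) := Ioc 0 ρ₀ ×ˢ {α}

/-- The annular sector `[d, ρ₀] × [α - 3π/4, α + 3π/4]`. -/
def annularSector (d ρ₀ α : ℝ) : Set (ℝ × ℝ) :=
  Icc d ρ₀ ×ˢ Icc (α - 3 * π / 4) (α + 3 * π / 4)

end

/-! The proof is a comparison with a catenoid-like barrier. Fix a small `c` and a point `(ρ, α)`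
with `ρ ≤ c`, and develop the sector of opening `2π` around the ray into the plane. Let `r` be the
distance to the point at distance `c` from the vertex, opposite to the ray, and let `k = c + ρ/2`.
The vertex has `r = c < k`, so the lune where `r ≥ k` within the disc of radius `c` stays away from
it and contains `(ρ, α)`.

The function `-2√(k(r - k))` is a strict supersolution for `r > k` with infinite slope at `r = k`,
so `v + 2√(k(r - k))` cannot attain its maximum over the lune off the arc of radius `c`
(`not_touching_barrier`). On that arc `r ≤ 2c` and the added term is at most `2c`; hence `v(ρ, α)`
exceeds the maximum of `v` on the arc by at most `2c` (`SolvesMSEOnCone.le_add_of_le_on_arc`). The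
error depends on neither `v` nor `α`, which gives (1) for small `c` and (2) by compactness; infima
follow from `v ↦ -v`. -/

/-! ### Second derivatives and the non-divergence form of the equation -/

/-- The second derivative test at a local maximum. -/
theorem IsLocalMax.second_deriv_nonpos {f f' : ℝ → ℝ} {a f'' : ℝ} (h : IsLocalMax f a)
    (hf : ∀ᶠ t in 𝓝 a, HasDerivAt f (f' t) t) (hf' : HasDerivAt f' f'' a) : f'' ≤ 0 := by
  by_contra! hpos
  have hd : deriv f =ᶠ[𝓝 a] f' := hf.mono fun t ht => ht.deriv
  have hdd : deriv (deriv f) a = f'' := by rw [hd.deriv_eq, hf'.deriv]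
  -- If `f'' > 0`, the point is also a local minimum, so `f` is locally constant and `f'' = 0`.
  have hmin : IsLocalMin f a :=
    isLocalMin_of_deriv_deriv_pos (by rw [hdd]; exact hpos) h.deriv_eq_zero
      hf.self_of_nhds.continuousAt
  have hc : f =ᶠ[𝓝 a] fun _ => f a := by
    filter_upwards [h, hmin] with t h1 h2 using le_antisymm h1 h2
  have h0 : deriv (deriv f) a = 0 := by
    rw [hc.deriv.deriv_eq]; simp
  linarith

theorem ContDiffAt.hasDerivAt_line {u : ℝ × ℝ → ℝ} {z : ℝ × ℝ} (hu : ContDiffAt ℝ 2 u z)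
    (ξ : ℝ × ℝ) :
    (∀ᶠ t in 𝓝 (0 : ℝ), HasDerivAt (fun t : ℝ => u (z + t • ξ)) (fderiv ℝ u (z + t • ξ) ξ) t) ∧
      HasDerivAt (fun t : ℝ => fderiv ℝ u (z + t • ξ) ξ) (fderiv ℝ (fderiv ℝ u) z ξ ξ) 0 := by
  have hline : ∀ t : ℝ, HasDerivAt (fun t : ℝ => z + t • ξ) ξ t := fun t => by
    simpa using ((hasDerivAt_id t).smul_const ξ).const_add z
  have hz : z + (0 : ℝ) • ξ = z := by simp
  constructor
  · have hev : ∀ᶠ w in 𝓝 z, DifferentiableAt ℝ u w :=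
      (hu.eventually (by simp)).mono fun w hw => hw.differentiableAt (by norm_num)
    have ht : Tendsto (fun t : ℝ => z + t • ξ) (𝓝 0) (𝓝 z) := by
      have := (hline 0).continuousAt.tendsto
      rwa [hz] at this
    filter_upwards [ht.eventually hev] with t ht
    exact ht.hasFDerivAt.comp_hasDerivAt t (hline t)
  · have hd : DifferentiableAt ℝ (fderiv ℝ u) (z + (0 : ℝ) • ξ) := by
      rw [hz]
      exact (hu.fderiv_right (m := 1) (by norm_num)).differentiableAt (by norm_num)
    have h1 := hd.hasFDerivAt.comp_hasDerivAt (0 : ℝ) (hline 0)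
    rw [hz] at h1
    have h2 := h1.clm_apply (hasDerivAt_const (0 : ℝ) ξ)
    simpa using h2

theorem areaDensity_pos (u : ℝ × ℝ → ℝ) (z : ℝ × ℝ) : 0 < areaDensity u z :=
  Real.sqrt_pos.2 (by positivity)

theorem fderiv_fderiv_div_areaDensity {u : ℝ × ℝ → ℝ} {z : ℝ × ℝ}
    (hu : ContDiffAt ℝ 2 u z) (ξ η : ℝ × ℝ) :
    fderiv ℝ (fun w => fderiv ℝ u w η / areaDensity u w) z ξ =
      fderiv ℝ (fderiv ℝ u) z ξ η / areaDensity u z - fderiv ℝ u z η *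
        (partialX u z * fderiv ℝ (fderiv ℝ u) z ξ (1, 0)
          + partialY u z * fderiv ℝ (fderiv ℝ u) z ξ (0, 1)) / areaDensity u z ^ 3 := by
  have hd : DifferentiableAt ℝ (fderiv ℝ u) z :=
    (hu.fderiv_right (m := 1) (by norm_num)).differentiableAt (by norm_num)
  have happ : ∀ ζ : ℝ × ℝ, HasLineDerivAt ℝ (fun w => fderiv ℝ u w ζ)
      (fderiv ℝ (fderiv ℝ u) z ξ ζ) z ξ := fun ζ => by
    have h := (hd.hasFDerivAt.clm_apply (hasFDerivAt_const ζ z)).hasLineDerivAt ξ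
    simpa using h
  have hW0 := areaDensity_pos u z
  have hpos : ∀ w, 1 + (partialX u w ^ 2 + partialY u w ^ 2) ≠ 0 := fun w => by positivity
  have hdiff : DifferentiableAt ℝ (fun w => fderiv ℝ u w η / areaDensity u w) z := by
    simp only [div_eq_mul_inv]
    refine (hd.clm_apply (differentiableAt_const η)).fun_mul (DifferentiableAt.fun_inv ?_ hW0.ne')
    refine DifferentiableAt.sqrt ?_ (hpos z)
    exact (((hd.clm_apply (differentiableAt_const (1, 0))).fun_pow 2).fun_add
      ((hd.clm_apply (differentiableAt_const (0, 1))).fun_pow 2)).const_add 1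
  have hz : z + (0 : ℝ) • ξ = z := by simp
  have hW : HasDerivAt (fun t : ℝ => areaDensity u (z + t • ξ)) _ 0 :=
    ((((happ (1, 0)).fun_pow 2).fun_add ((happ (0, 1)).fun_pow 2)).const_add 1).sqrt
      (hpos (z + (0 : ℝ) • ξ))
  have hq : HasLineDerivAt ℝ (fun w => fderiv ℝ u w η / areaDensity u w) _ z ξ := (happ η).fun_div hW (by rw [hz]; exact hW0.ne')
  rw [← hdiff.lineDeriv_eq_fderiv, hq.lineDeriv, hz]
  simp only
  change (_ * areaDensity u z - fderiv ℝ u z η * ((_ * partialX u z ^ _ * _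
    + _ * partialY u z ^ _ * _) / (2 * areaDensity u z))) / _ = _
  field_simp
  norm_num
  ring

/-- The minimal surface operator in non-divergence form. -/
theorem minimalSurfaceOperator_mul_areaDensity_pow {u : ℝ × ℝ → ℝ} {z : ℝ × ℝ}
    (hu : ContDiffAt ℝ 2 u z) :
    minimalSurfaceOperator u z * areaDensity u z ^ 3 =
      (1 + partialY u z ^ 2) * fderiv ℝ (fderiv ℝ u) z (1, 0) (1, 0)
      - partialX u z * partialY u z * (fderiv ℝ (fderiv ℝ u) z (1, 0) (0, 1)
        + fderiv ℝ (fderiv ℝ u) z (0, 1) (1, 0))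
      + (1 + partialX u z ^ 2) * fderiv ℝ (fderiv ℝ u) z (0, 1) (0, 1) := by
  have hW0 := areaDensity_pos u z
  have hW2 : areaDensity u z ^ 2 = 1 + (partialX u z ^ 2 + partialY u z ^ 2) :=
    Real.sq_sqrt (by positivity)
  have hX := fderiv_fderiv_div_areaDensity hu (1, 0) (1, 0)
  have hY := fderiv_fderiv_div_areaDensity hu (0, 1) (0, 1)
  change partialX (fun w => partialX u w / areaDensity u w) z = _ - partialX u z * _ / _ at hX
  change partialY (fun w => partialY u w / areaDensity u w) z = _ - partialY u z * _ / _ at hY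
  rw [minimalSurfaceOperator, hX, hY]
  generalize areaDensity u z = W at *
  field_simp
  rw [hW2]
  ring

/-- In an orthonormal frame whose first vector is parallel to the gradient, the minimal surface
equation is a combination of two pure second derivatives. -/
theorem second_deriv_frame_eq_zero {u : ℝ × ℝ → ℝ} {z : ℝ × ℝ} {e₁ e₂ : ℝ}
    (hu : ContDiffAt ℝ 2 u z) (h0 : minimalSurfaceOperator u z = 0) (he : e₁ ^ 2 + e₂ ^ 2 = 1)
    (hη : fderiv ℝ u z (-e₂, e₁) = 0) :
    fderiv ℝ (fderiv ℝ u) z (e₁, e₂) (e₁, e₂)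
      + (1 + fderiv ℝ u z (e₁, e₂) ^ 2)
        * fderiv ℝ (fderiv ℝ u) z (-e₂, e₁) (-e₂, e₁) = 0 := by
  have key := minimalSurfaceOperator_mul_areaDensity_pow hu
  rw [h0, zero_mul] at key
  have hdec : ∀ x y : ℝ, (x, y) = x • ((1, 0) : ℝ × ℝ) + y • ((0, 1) : ℝ × ℝ) := by
    intro x y; simp
  have hL : ∀ x y : ℝ, fderiv ℝ u z (x, y) = x * partialX u z + y * partialY u z := by
    intro x y
    rw [hdec, map_add, map_smul, map_smul]; rfl
  have hH : ∀ x y : ℝ, fderiv ℝ (fderiv ℝ u) z (x, y) (x, y) =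
      x * (x * fderiv ℝ (fderiv ℝ u) z (1, 0) (1, 0) + y * fderiv ℝ (fderiv ℝ u) z (1, 0) (0, 1))
      + y * (x * fderiv ℝ (fderiv ℝ u) z (0, 1) (1, 0)
        + y * fderiv ℝ (fderiv ℝ u) z (0, 1) (0, 1)) := by
    intro x y
    rw [hdec, map_add, map_smul, map_smul]
    simp only [add_apply, smul_apply, map_add, map_smul,
      smul_eq_mul]
    ring
  rw [hL] at hη
  set q := e₁ * partialX u z + e₂ * partialY u z with hq
  have hX : partialX u z = q * e₁ := by linear_combination (-partialX u z) * he - e₂ * hη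
  have hY : partialY u z = q * e₂ := by linear_combination (-partialY u z) * he + e₁ * hη
  rw [hX, hY] at key
  rw [hL, hH e₁ e₂, hH (-e₂) e₁, ← hq]
  generalize fderiv ℝ (fderiv ℝ u) z (1, 0) (1, 0) = A at *
  generalize fderiv ℝ (fderiv ℝ u) z (1, 0) (0, 1) = B at *
  generalize fderiv ℝ (fderiv ℝ u) z (0, 1) (1, 0) = C at *
  generalize fderiv ℝ (fderiv ℝ u) z (0, 1) (0, 1) = D at *
  linear_combination (A + D) * he - key

/-! ### Sign change, restriction and the developing map -/

theorem minimalSurfaceOperator_neg (u : ℝ × ℝ → ℝ) (z : ℝ × ℝ) :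
    minimalSurfaceOperator (fun w => -u w) z = -minimalSurfaceOperator u z := by
  have hX : ∀ u : ℝ × ℝ → ℝ, ∀ w, partialX (fun w => -u w) w = -partialX u w := fun u w => by
    simp [partialX, fderiv_fun_neg]
  have hY : ∀ u : ℝ × ℝ → ℝ, ∀ w, partialY (fun w => -u w) w = -partialY u w := fun u w => by
    simp [partialY, fderiv_fun_neg]
  have hW : ∀ w, areaDensity (fun w => -u w) w = areaDensity u w := fun w => by
    simp [areaDensity, hX, hY]
  simp only [minimalSurfaceOperator, hX, hY, hW, neg_div]
  ring

theorem SolvesMSEOnCone.neg {v : ℝ × ℝ → ℝ} {S : Set (ℝ × ℝ)} (h : SolvesMSEOnCone v S) :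
    SolvesMSEOnCone (fun p => -v p) S := by
  refine ⟨h.1.neg, fun p hp => ?_⟩
  obtain ⟨u, U, hpU, ⟨hU, hu, h0⟩, hv⟩ := h.2 p hp
  refine ⟨fun w => -u w, U, hpU, ⟨hU, hu.neg, fun z hz => ?_⟩, ?_⟩
  · rw [minimalSurfaceOperator_neg, h0 z hz, neg_zero]
  · filter_upwards [hv] with q hq using by simp [hq]

theorem SolvesMSEOnCone.mono {v : ℝ × ℝ → ℝ} {S T : Set (ℝ × ℝ)} (h : SolvesMSEOnCone v T)
    (hST : S ⊆ T) : SolvesMSEOnCone v S :=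
  ⟨h.1.mono hST, fun p hp => h.2 p (interior_mono hST hp)⟩

theorem contDiff_develop : ContDiff ℝ 2 develop := by
  unfold develop; fun_prop

/-- The Jacobian of `develop` is `ρ ≠ 0`. This carries a local maximum in polar coordinates to one
in the plane without constructing a local inverse. -/
theorem map_develop_nhds {p : ℝ × ℝ} (hp : 0 < p.1) : map develop (𝓝 p) = 𝓝 (develop p) := by
  have hs : HasStrictFDerivAt develop (fderiv ℝ develop p) p :=
    contDiff_develop.contDiffAt.hasStrictFDerivAt (by norm_num)
  refine hs.map_nhds_eq_of_surj (LinearMap.range_eq_top.2 fun q => ?_)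
  have hf : HasFDerivAt develop _ p := HasFDerivAt.prodMk (𝕜 := ℝ)
      (hasFDerivAt_fst.fun_mul ((hasDerivAt_cos p.2).comp_hasFDerivAt p hasFDerivAt_snd))
      (hasFDerivAt_fst.fun_mul ((hasDerivAt_sin p.2).comp_hasFDerivAt p hasFDerivAt_snd))
  refine ⟨(q.1 * cos p.2 + q.2 * sin p.2, (-q.1 * sin p.2 + q.2 * cos p.2) / p.1), ?_⟩
  have h1 := sin_sq_add_cos_sq p.2
  rw [hf.fderiv]
  ext
  · simp
    field_simp
    linear_combination q.1 * h1
  · simp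
    field_simp
    linear_combination q.2 * h1

/-! ### The barrier -/

/-- A solution of the minimal surface equation does not touch from below the graph of
`-2 √(k (r - k))` over `{r ≥ k}`, where `r` is the distance to a given point: this function is a
strict supersolution for `r > k`, and its slope is infinite at `r = k`. -/
theorem not_touching_barrier {u : ℝ × ℝ → ℝ} {a b k r e₁ e₂ : ℝ} (he : e₁ ^ 2 + e₂ ^ 2 = 1)
    (hk : 0 < k) (hr : k ≤ r) (hu : ContDiffAt ℝ 2 u (a + r * e₁, b + r * e₂))
    (h0 : minimalSurfaceOperator u (a + r * e₁, b + r * e₂) = 0)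
    (hmax : ∀ᶠ w in 𝓝 (a + r * e₁, b + r * e₂), k ≤ √((w.1 - a) ^ 2 + (w.2 - b) ^ 2) →
      u w + 2 * √(k * (√((w.1 - a) ^ 2 + (w.2 - b) ^ 2) - k)) ≤
        u (a + r * e₁, b + r * e₂) + 2 * √(k * (r - k))) : False := by
  have hr0 : 0 < r := hk.trans_le hr
  set z : ℝ × ℝ := (a + r * e₁, b + r * e₂) with hz
  have hline : ∀ ξ : ℝ × ℝ, Tendsto (fun t : ℝ => z + t • ξ) (𝓝 0) (𝓝 z) := fun ξ => by
    have : Continuous fun t : ℝ => z + t • ξ := by fun_prop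
    simpa using this.tendsto 0
  have hrad : ∀ᶠ t in 𝓝 (0 : ℝ), k ≤ r + t →
      u (z + t • (e₁, e₂)) + 2 * √(k * (r + t - k)) ≤ u z + 2 * √(k * (r - k)) := by
    filter_upwards [(hline (e₁, e₂)).eventually hmax] with t ht hkt
    have hd : √(((z + t • (e₁, e₂)).1 - a) ^ 2 + ((z + t • (e₁, e₂)).2 - b) ^ 2) = r + t := by
      rw [Real.sqrt_eq_iff_mul_self_eq_of_pos (by linarith)]
      simp [hz]
      linear_combination (-(r + t) ^ 2) * he
    rw [hd] at ht
    exact ht hkt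
  obtain ⟨hd1, hd2⟩ := hu.hasDerivAt_line (e₁, e₂)
  have hz0 : ∀ ξ : ℝ × ℝ, z + (0 : ℝ) • ξ = z := fun ξ => by simp
  -- At `r = k`, moving outward by `t` raises the added term by `2√(kt)`, while `u` changes by only
  -- `O(t)`.
  rcases hr.eq_or_lt with rfl | hkr
  · obtain ⟨C, hC⟩ := (hd1.self_of_nhds.differentiableAt.isBigO_sub).bound
    have hsq : Tendsto (fun t : ℝ => C * √t) (𝓝[>] 0) (𝓝 0) := by
      have : Continuous fun t : ℝ => C * √t := by fun_prop
      simpa using (this.tendsto 0).mono_left nhdsWithin_le_nhds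
    have hge : ∀ᶠ t in 𝓝[>] (0 : ℝ), 2 * √k ≤ C * √t := by
      filter_upwards [nhdsWithin_le_nhds hrad, nhdsWithin_le_nhds hC, self_mem_nhdsWithin]
        with t h1 h2 (ht : 0 < t)
      have h1 := h1 (by linarith)
      rw [hz0, sub_zero, Real.norm_eq_abs, Real.norm_eq_abs, abs_of_pos ht] at h2
      have h3 := (abs_le.1 h2).1
      rw [show k + t - k = t by ring, Real.sqrt_mul hk.le, sub_self, mul_zero, Real.sqrt_zero]
        at h1
      have h4 : t = √t * √t := (Real.mul_self_sqrt ht.le).symm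
      have h5 : 0 < √t := Real.sqrt_pos.2 ht
      refine le_of_mul_le_mul_right ?_ h5
      calc 2 * √k * √t ≤ C * t := by linarith
        _ = C * √t * √t := by rw [mul_assoc, ← h4]
    have := ge_of_tendsto hsq hge
    have := Real.sqrt_pos.2 hk
    linarith
  · have hkr' : 0 < k * (r - k) := mul_pos hk (by linarith)
    set s := √(k * (r - k)) with hs
    have hs0 : 0 < s := Real.sqrt_pos.2 hkr'
    have hs2 : s ^ 2 = k * (r - k) := Real.sq_sqrt hkr'.le
    -- the radial direction
    have hin : ∀ t : ℝ, HasDerivAt (fun t : ℝ => k * (r + t - k)) k t := fun t => by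
      simpa using (((hasDerivAt_id t).const_add r).sub_const k).const_mul k
    have hev : ∀ᶠ t in 𝓝 (0 : ℝ), 0 < r + t - k := by
      have : Continuous fun t : ℝ => r + t - k := by fun_prop
      exact this.continuousAt.eventually (lt_mem_nhds (by simpa using hkr))
    have hM1 : IsLocalMax (fun t : ℝ => u (z + t • (e₁, e₂)) + 2 * √(k * (r + t - k))) 0 := by
      filter_upwards [hrad, hev] with t h1 h2
      simpa [hz0] using h1 (by linarith)
    have hD1 : ∀ᶠ t in 𝓝 (0 : ℝ), HasDerivAt
        (fun t : ℝ => u (z + t • (e₁, e₂)) + 2 * √(k * (r + t - k)))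
        (fderiv ℝ u (z + t • (e₁, e₂)) (e₁, e₂) + k * (√(k * (r + t - k)))⁻¹) t := by
      filter_upwards [hd1, hev] with t h1 h2
      have h3 := ((hin t).sqrt (mul_pos hk h2).ne').const_mul 2
      refine (h1.fun_add h3).congr_deriv ?_
      field_simp
    have hD2 : HasDerivAt
        (fun t : ℝ => fderiv ℝ u (z + t • (e₁, e₂)) (e₁, e₂) + k * (√(k * (r + t - k)))⁻¹)
        (fderiv ℝ (fderiv ℝ u) z (e₁, e₂) (e₁, e₂) - k ^ 2 / (2 * s ^ 3)) 0 := by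
      have h3 := (((hin 0).sqrt (by simpa using hkr'.ne')).fun_inv
        (by simpa using hs0.ne')).const_mul k
      refine (hd2.fun_add h3).congr_deriv ?_
      rw [add_zero, ← hs]
      field_simp
      ring
    have hrr := hM1.second_deriv_nonpos hD1 hD2
    have hgr := hM1.hasDerivAt_eq_zero hD1.self_of_nhds
    rw [hz0, add_zero, ← hs] at hgr
    -- the tangential direction
    have htan : ∀ᶠ t in 𝓝 (0 : ℝ),
        u (z + t • (-e₂, e₁)) + 2 * √(k * (√(r ^ 2 + t ^ 2) - k)) ≤ u z + 2 * s := by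
      filter_upwards [(hline (-e₂, e₁)).eventually hmax] with t ht
      have hd : ((z + t • (-e₂, e₁)).1 - a) ^ 2 + ((z + t • (-e₂, e₁)).2 - b) ^ 2
          = r ^ 2 + t ^ 2 := by
        simp [hz]
        linear_combination (r ^ 2 + t ^ 2) * he
      rw [hd] at ht
      exact ht (Real.le_sqrt_of_sq_le (by nlinarith [sq_nonneg t]))
    have hsr : √(r ^ 2 + (0 : ℝ) ^ 2) = r := by simp [Real.sqrt_sq hr0.le]
    have hrt : ∀ t : ℝ, 0 < r ^ 2 + t ^ 2 := fun t => by positivity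
    have hrt' : ∀ t : ℝ, 0 < √(r ^ 2 + t ^ 2) - k := fun t => by
      have : r ≤ √(r ^ 2 + t ^ 2) := Real.le_sqrt_of_sq_le (by nlinarith [sq_nonneg t])
      linarith
    obtain ⟨hd1', hd2'⟩ := hu.hasDerivAt_line (-e₂, e₁)
    have hin' : ∀ t : ℝ, HasDerivAt (fun t : ℝ => k * (√(r ^ 2 + t ^ 2) - k))
        (k * (t / √(r ^ 2 + t ^ 2))) t := fun t => by
      refine (((((hasDerivAt_pow 2 t).const_add (r ^ 2)).sqrt
        (hrt t).ne').sub_const k).const_mul k).congr_deriv ?_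
      have := Real.sqrt_pos.2 (hrt t)
      field_simp
      norm_num
    have hM2 : IsLocalMax
        (fun t : ℝ => u (z + t • (-e₂, e₁)) + 2 * √(k * (√(r ^ 2 + t ^ 2) - k))) 0 := by
      filter_upwards [htan] with t h1
      simpa only [hz0, hsr, ← hs] using h1
    have hE1 : ∀ᶠ t in 𝓝 (0 : ℝ), HasDerivAt
        (fun t : ℝ => u (z + t • (-e₂, e₁)) + 2 * √(k * (√(r ^ 2 + t ^ 2) - k)))
        (fderiv ℝ u (z + t • (-e₂, e₁)) (-e₂, e₁)
          + t * (k / √(r ^ 2 + t ^ 2) / √(k * (√(r ^ 2 + t ^ 2) - k)))) t := by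
      filter_upwards [hd1'] with t h1
      have h3 := ((hin' t).sqrt (mul_pos hk (hrt' t)).ne').const_mul 2
      refine (h1.fun_add h3).congr_deriv ?_
      field_simp
    -- The tangential derivative of the barrier term has the form `t * h t`, so its derivative at
    -- `0` is `h 0`; `h` need only be differentiable there.
    have hE2 : HasDerivAt
        (fun t : ℝ => fderiv ℝ u (z + t • (-e₂, e₁)) (-e₂, e₁)
          + t * (k / √(r ^ 2 + t ^ 2) / √(k * (√(r ^ 2 + t ^ 2) - k))))
        (fderiv ℝ (fderiv ℝ u) z (-e₂, e₁) (-e₂, e₁) + k / r / s) 0 := by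
      have hh : DifferentiableAt ℝ
          (fun t : ℝ => k / √(r ^ 2 + t ^ 2) / √(k * (√(r ^ 2 + t ^ 2) - k))) 0 := by
        have h1 : DifferentiableAt ℝ (fun t : ℝ => √(r ^ 2 + t ^ 2)) 0 :=
          DifferentiableAt.sqrt (by fun_prop) (hrt 0).ne'
        refine ((differentiableAt_const k).fun_div h1 (by rw [hsr]; exact hr0.ne')).fun_div
          ((hin' 0).differentiableAt.sqrt ?_) ?_
        · rw [hsr]; exact hkr'.ne'
        · rw [hsr, ← hs]; exact hs0.ne'
      have h3 := (hasDerivAt_id (0 : ℝ)).fun_mul hh.hasDerivAt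
      refine (hd2'.fun_add h3).congr_deriv ?_
      simp only [hsr, ← hs, id, one_mul, zero_mul, add_zero]
    have htt := hM2.second_deriv_nonpos hE1 hE2
    have hgt := hM2.hasDerivAt_eq_zero hE1.self_of_nhds
    rw [hz0, zero_mul, add_zero] at hgt
    have key := second_deriv_frame_eq_zero hu h0 he hgt
    have hq : fderiv ℝ u z (e₁, e₂) ^ 2 = k ^ 2 / s ^ 2 := by
      rw [eq_neg_of_add_eq_zero_left hgr]; field_simp
    rw [hq] at key
    -- Since `s² + k² = kr`, the tangential term is exactly twice the radial one, `k²/(2s³)`, with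
    -- opposite sign: this makes the supersolution strict.
    have h1 : (1 + k ^ 2 / s ^ 2) * (k / r / s) = k ^ 2 / s ^ 3 := by
      field_simp
      rw [hs2]; ring
    have h2 : (1 + k ^ 2 / s ^ 2) * fderiv ℝ (fderiv ℝ u) z (-e₂, e₁) (-e₂, e₁)
        ≤ (1 + k ^ 2 / s ^ 2) * (-(k / r / s)) :=
      mul_le_mul_of_nonneg_left (by linarith) (by positivity)
    have h3 : k ^ 2 / (2 * s ^ 3) = k ^ 2 / s ^ 3 / 2 := by field_simp
    have h4 : 0 < k ^ 2 / s ^ 3 := by positivity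
    linarith

/-! ### Comparison on the lune -/

/-- The law of cosines, for the barrier centred at `-c (cos α, sin α)`. -/
theorem dist_develop_sq (ρ θ α c : ℝ) :
    ((develop (ρ, θ)).1 - -c * cos α) ^ 2 + ((develop (ρ, θ)).2 - -c * sin α) ^ 2 =
      ρ ^ 2 + c ^ 2 + 2 * ρ * c * cos (θ - α) := by
  simp only [develop, cos_sub]
  linear_combination ρ ^ 2 * sin_sq_add_cos_sq θ + c ^ 2 * sin_sq_add_cos_sq α

theorem cos_three_pi_div_four : cos (3 * π / 4) = -(√2 / 2) := by
  rw [show 3 * π / 4 = π - π / 4 by ring, cos_pi_sub, cos_pi_div_four]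

theorem annularSector_subset_coneSector {d ρ₀ α : ℝ} (hd : 0 < d) :
    annularSector d ρ₀ α ⊆ coneSector ρ₀ (α - π) (α + π) := by
  rintro ⟨ρ, θ⟩ ⟨⟨h1, h2⟩, h3, h4⟩
  have := pi_pos
  exact ⟨⟨hd.trans_le h1, h2⟩, by dsimp at *; linarith, by dsimp at *; linarith⟩

theorem isCompact_annularSector (d ρ₀ α : ℝ) : IsCompact (annularSector d ρ₀ α) :=
  isCompact_Icc.prod isCompact_Icc

/-- Close to the vertex, a solution on the ray `θ = α` exceeds its maximum on the arc of radius
`c` and half-opening `3π/4` by at most `2c`. -/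
theorem SolvesMSEOnCone.le_add_of_le_on_arc {ρ₀ α c M : ℝ} {v : ℝ × ℝ → ℝ} (hc : 0 < c)
    (hcρ : c < ρ₀) (hv : SolvesMSEOnCone v (coneSector ρ₀ (α - π) (α + π)))
    (hM : ∀ θ ∈ Icc (α - 3 * π / 4) (α + 3 * π / 4), v (c, θ) ≤ M) {ρ : ℝ} (hρ : 0 < ρ)
    (hρc : ρ ≤ c) : v (ρ, α) ≤ M + 2 * c := by
  have hπ := pi_pos
  set s := ρ / 2 with hs
  have hs0 : 0 < s := by positivity
  set k := c + s with hk
  have hk0 : 0 < k := by positivity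
  set R : ℝ × ℝ → ℝ := fun w => √((w.1 - -c * cos α) ^ 2 + (w.2 - -c * sin α) ^ 2) with hR
  have hRc : Continuous R := by fun_prop
  have hdc : Continuous develop := contDiff_develop.continuous
  -- The bound `s / 2` is slack: `k ≤ r ≤ x + c` forces `x ≥ s`, so the inner edge of the box is
  -- never reached.
  set K : Set (ℝ × ℝ) := (Icc (s / 2) c ×ˢ Icc (α - 3 * π / 4) (α + 3 * π / 4)) ∩
    {p | k ≤ R (develop p)} with hK
  have hKc : IsCompact K := (isCompact_Icc.prod isCompact_Icc).inter_right
    (isClosed_le continuous_const (hRc.comp hdc))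
  have hKS : K ⊆ coneSector ρ₀ (α - π) (α + π) := by
    rintro ⟨x, θ⟩ ⟨⟨⟨h1, h2⟩, h3, h4⟩, -⟩
    dsimp at *
    exact ⟨⟨by dsimp; linarith, by dsimp; linarith⟩, by dsimp; linarith, by dsimp; linarith⟩
  set g : ℝ × ℝ → ℝ := fun p => v p + 2 * √(k * (R (develop p) - k)) with hg
  have hgc : ContinuousOn g K := (hv.1.mono hKS).add (by fun_prop)
  have hRray : R (develop (ρ, α)) = c + ρ := by
    simp only [hR]
    rw [dist_develop_sq, sub_self, cos_zero, Real.sqrt_eq_iff_mul_self_eq_of_pos (by linarith)]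
    ring
  have hmem : (ρ, α) ∈ K := by
    refine ⟨⟨⟨?_, hρc⟩, ?_, ?_⟩, ?_⟩
    · dsimp; linarith
    · dsimp; linarith
    · dsimp; linarith
    · change k ≤ R (develop (ρ, α))
      rw [hRray]; linarith
  obtain ⟨⟨x, θ⟩, hp, hpmax⟩ := hKc.exists_isMaxOn ⟨_, hmem⟩ hgc
  obtain ⟨⟨⟨hx1, hx2⟩, hθ⟩, hpk⟩ := id hp
  change k ≤ R (develop (x, θ)) at hpk
  dsimp only at hx1 hx2 hθ
  have hx0 : 0 < x := by linarith
  set r := R (develop (x, θ)) with hr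
  have hr0 : 0 < r := hk0.trans_le hpk
  have hr2 : r ^ 2 = x ^ 2 + c ^ 2 + 2 * x * c * cos (θ - α) := by
    rw [hr]; simp only [hR]
    rw [dist_develop_sq, Real.sq_sqrt]
    rw [← dist_develop_sq]; positivity
  have hxc : 0 < x * c := by positivity
  have hrle : r ≤ x + c := by
    refine abs_le_of_sq_le_sq' ?_ (by linarith) |>.2
    rw [hr2]
    nlinarith [mul_le_mul_of_nonneg_left (cos_le_one (θ - α)) hxc.le]
  have hle : v (ρ, α) ≤ g (x, θ) :=
    (le_add_of_nonneg_right (by positivity)).trans (hpmax hmem)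
  rcases hx2.eq_or_lt with rfl | hxc'
  · have h1 : √(k * (r - k)) ≤ x := by
      refine Real.sqrt_le_iff.2 ⟨hx0.le, ?_⟩
      nlinarith [sq_nonneg s]
    have h2 := hM θ hθ
    change v (ρ, α) ≤ v (x, θ) + 2 * √(k * (r - k)) at hle
    linarith
  exfalso
  have hkk : k ^ 2 ≤ r ^ 2 := pow_le_pow_left₀ hk0.le hpk 2
  have hck : c ^ 2 < k ^ 2 := pow_lt_pow_left₀ (by linarith) hc.le (by norm_num)
  have hxs : s ≤ x := by linarith
  -- On the lateral sides `r² = x² + c² - √2 x c`, so `r > c` would force `x > √2 c`, outside the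
  -- disc.
  have hcos : cos (θ - α) = cos (3 * π / 4) → False := fun h => by
    rw [hr2, h, cos_three_pi_div_four] at hkk
    have h2 : (0 : ℝ) < x * (x - c * √2) := by nlinarith
    have h3 : (1 : ℝ) ≤ √2 := Real.one_le_sqrt.2 (by norm_num)
    have h4 := (mul_pos_iff_of_pos_left hx0).1 h2
    nlinarith
  have hθ1 : θ ≠ α + 3 * π / 4 := fun h => hcos (by rw [h]; congr 1; ring)
  have hθ2 : θ ≠ α - 3 * π / 4 := fun h => hcos (by rw [h, ← cos_neg]; congr 1; ring)
  have hθ1' : θ < α + 3 * π / 4 := lt_of_le_of_ne hθ.2 hθ1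
  have hθ2' : α - 3 * π / 4 < θ := lt_of_le_of_ne hθ.1 (Ne.symm hθ2)
  have hint : (x, θ) ∈ interior (coneSector ρ₀ (α - π) (α + π)) := by
    refine interior_mono (prod_mono Ioo_subset_Ioc_self subset_rfl) ?_
    rw [(isOpen_Ioo.prod isOpen_Ioo).interior_eq]
    exact ⟨⟨hx0, hxc'.trans hcρ⟩, by dsimp; linarith, by dsimp; linarith⟩
  obtain ⟨u, U, hU, ⟨hUo, hu, hu0⟩, huv⟩ := hv.2 _ hint
  have hbox : ∀ᶠ p in 𝓝 (x, θ), p ∈ Icc (s / 2) c ×ˢ Icc (α - 3 * π / 4) (α + 3 * π / 4) :=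
    prod_mem_nhds (Icc_mem_nhds (by linarith) hxc') (Icc_mem_nhds hθ2' hθ1')
  have hev : ∀ᶠ w in 𝓝 (develop (x, θ)), k ≤ R w →
      u w + 2 * √(k * (R w - k)) ≤ u (develop (x, θ)) + 2 * √(k * (r - k)) := by
    rw [← map_develop_nhds hx0, eventually_map]
    have huv0 : v (x, θ) = u (develop (x, θ)) := huv.self_of_nhds
    filter_upwards [hbox, huv] with p h1 h2 h3
    have h4 : g p ≤ g (x, θ) := hpmax ⟨h1, h3⟩
    change v p = u (develop p) at h2
    rw [← h2, ← huv0]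
    exact h4
  set e₁ := ((develop (x, θ)).1 - -c * cos α) / r with he₁
  set e₂ := ((develop (x, θ)).2 - -c * sin α) / r with he₂
  have hz : develop (x, θ) = (-c * cos α + r * e₁, -c * sin α + r * e₂) := by
    rw [he₁, he₂, mul_div_cancel₀ _ hr0.ne', mul_div_cancel₀ _ hr0.ne']
    ext <;> simp
  have he : e₁ ^ 2 + e₂ ^ 2 = 1 := by
    rw [he₁, he₂, div_pow, div_pow, ← add_div, dist_develop_sq, ← hr2, div_self (by positivity)]
  have huz := hu.contDiffAt (hUo.mem_nhds hU)
  have hu0z := hu0 _ hU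
  rw [hz] at huz hu0z hev
  exact not_touching_barrier he hk0 hpk huz hu0z hev

/-! ### Suprema, infima and boundedness -/

theorem SolvesMSEOnCone.exists_le_sSup_add {ρ₀ α c : ℝ} {v : ℝ × ℝ → ℝ} (hc : 0 < c)
    (hcρ : c < ρ₀) (hv : SolvesMSEOnCone v (coneSector ρ₀ (α - π) (α + π))) :
    BddAbove (v '' annularSector c ρ₀ α) ∧
      ∀ p ∈ coneRay ρ₀ α, v p ≤ sSup (v '' annularSector c ρ₀ α) + 2 * c := by
  have hπ := pi_pos
  have hb : BddAbove (v '' annularSector c ρ₀ α) := (isCompact_annularSector c ρ₀ α).bddAbove_image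
    (hv.1.mono (annularSector_subset_coneSector hc))
  refine ⟨hb, ?_⟩
  rintro ⟨ρ, θ⟩ ⟨⟨h1, h2⟩, rfl : θ = α⟩
  rcases le_total ρ c with h | h
  · exact hv.le_add_of_le_on_arc hc hcρ
      (fun φ hφ => le_csSup hb ⟨(c, φ), ⟨⟨le_rfl, hcρ.le⟩, hφ⟩, rfl⟩) h1 h
  · have : v (ρ, θ) ≤ sSup (v '' annularSector c ρ₀ θ) :=
      le_csSup hb ⟨(ρ, θ), ⟨⟨h, h2⟩, by dsimp; linarith, by dsimp; linarith⟩, rfl⟩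
    linarith

theorem SolvesMSEOnCone.sSup_ray_lt {ρ₀ α c ε : ℝ} {v : ℝ × ℝ → ℝ} (hc : 0 < c)
    (hcρ : c < ρ₀) (hcε : 2 * c < ε)
    (hv : SolvesMSEOnCone v (coneSector ρ₀ (α - π) (α + π))) :
    BddAbove (v '' coneRay ρ₀ α) ∧ BddAbove (v '' annularSector c ρ₀ α) ∧
      sSup (v '' coneRay ρ₀ α) < sSup (v '' annularSector c ρ₀ α) + ε := by
  obtain ⟨hb, hle⟩ := hv.exists_le_sSup_add hc hcρ
  have hub : ∀ y ∈ v '' coneRay ρ₀ α, y ≤ sSup (v '' annularSector c ρ₀ α) + 2 * c := by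
    rintro _ ⟨p, hp, rfl⟩
    exact hle p hp
  refine ⟨⟨_, hub⟩, hb, ?_⟩
  have hne : (v '' coneRay ρ₀ α).Nonempty :=
    ⟨_, (ρ₀, α), ⟨⟨hc.trans hcρ, le_rfl⟩, rfl⟩, rfl⟩
  linarith [csSup_le hne hub]

theorem image_neg_eq (v : ℝ × ℝ → ℝ) (S : Set (ℝ × ℝ)) : (fun p => -v p) '' S = -(v '' S) := by
  rw [← Set.image_neg_eq_neg, Set.image_image]

theorem SolvesMSEOnCone.sInf_ray_gt {ρ₀ α c ε : ℝ} {v : ℝ × ℝ → ℝ} (hc : 0 < c)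
    (hcρ : c < ρ₀) (hcε : 2 * c < ε)
    (hv : SolvesMSEOnCone v (coneSector ρ₀ (α - π) (α + π))) :
    BddBelow (v '' coneRay ρ₀ α) ∧ BddBelow (v '' annularSector c ρ₀ α) ∧
      sInf (v '' coneRay ρ₀ α) > sInf (v '' annularSector c ρ₀ α) - ε := by
  have h := hv.neg.sSup_ray_lt hc hcρ hcε
  rw [image_neg_eq, image_neg_eq, bddAbove_neg, bddAbove_neg, Real.sSup_neg, Real.sSup_neg] at h
  exact ⟨h.1, h.2.1, by linarith [h.2.2]⟩

theorem SolvesMSEOnCone.exists_le_on_sector {ρ₀ θ₁ θ₂ : ℝ} {v : ℝ × ℝ → ℝ} (hρ₀ : 0 < ρ₀)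
    (hv : SolvesMSEOnCone v (coneSector ρ₀ (θ₁ - π) (θ₂ + π))) :
    ∃ C : ℝ, ∀ ρ ∈ Ioc 0 ρ₀, ∀ θ ∈ Icc θ₁ θ₂, v (ρ, θ) ≤ C := by
  have hπ := pi_pos
  set c := ρ₀ / 2 with hc
  have hc0 : 0 < c := by positivity
  have hcρ : c < ρ₀ := by linarith
  have hcomp : IsCompact (Icc c ρ₀ ×ˢ Icc (θ₁ - 3 * π / 4) (θ₂ + 3 * π / 4)) :=
    isCompact_Icc.prod isCompact_Icc
  obtain ⟨C, hC⟩ := hcomp.bddAbove_image (f := v) (hv.1.mono (by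
    rintro ⟨ρ, θ⟩ ⟨⟨h1, h2⟩, h3, h4⟩
    dsimp at *
    exact ⟨⟨hc0.trans_le h1, h2⟩, by dsimp; linarith, by dsimp; linarith⟩))
  -- The annular sectors of all rays `θ ∈ [θ₁, θ₂]` lie in one compact set, so `C` serves them all.
  refine ⟨C + 2 * c, fun ρ hρ θ hθ => ?_⟩
  have hv' : SolvesMSEOnCone v (coneSector ρ₀ (θ - π) (θ + π)) :=
    hv.mono (prod_mono subset_rfl (Ioo_subset_Ioo (by linarith [hθ.1]) (by linarith [hθ.2])))
  refine ((hv'.exists_le_sSup_add hc0 hcρ).2 (ρ, θ) ⟨hρ, rfl⟩).trans ?_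
  have hsub : annularSector c ρ₀ θ ⊆ Icc c ρ₀ ×ˢ Icc (θ₁ - 3 * π / 4) (θ₂ + 3 * π / 4) :=
    prod_mono subset_rfl (Icc_subset_Icc (by linarith [hθ.1]) (by linarith [hθ.2]))
  have hne : (v '' annularSector c ρ₀ θ).Nonempty :=
    ⟨_, (c, θ), ⟨⟨le_rfl, hcρ.le⟩, by dsimp; linarith, by dsimp; linarith⟩, rfl⟩
  have : sSup (v '' annularSector c ρ₀ θ) ≤ C :=
    csSup_le hne fun y hy => hC (image_mono hsub hy)
  linarith

theorem mainTheorem10 (ρ₀ : ℝ) (hρ₀ : 0 < ρ₀) :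
    (∀ ε : ℝ, 0 < ε → ∃ d : ℝ, 0 < d ∧ d < ρ₀ ∧
      ∀ (α : ℝ) (v : ℝ × ℝ → ℝ), SolvesMSEOnCone v (coneSector ρ₀ (α - π) (α + π)) →
        (BddAbove (v '' coneRay ρ₀ α) ∧ BddAbove (v '' annularSector d ρ₀ α) ∧
          sSup (v '' coneRay ρ₀ α) < sSup (v '' annularSector d ρ₀ α) + ε) ∧
        (BddBelow (v '' coneRay ρ₀ α) ∧ BddBelow (v '' annularSector d ρ₀ α) ∧
          sInf (v '' coneRay ρ₀ α) > sInf (v '' annularSector d ρ₀ α) - ε)) ∧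
    (∀ (θ₁ θ₂ : ℝ) (v : ℝ × ℝ → ℝ), θ₁ ≤ θ₂ →
      SolvesMSEOnCone v (coneSector ρ₀ (θ₁ - π) (θ₂ + π)) →
        ∃ C : ℝ, ∀ ρ ∈ Ioc 0 ρ₀, ∀ θ ∈ Icc θ₁ θ₂, |v (ρ, θ)| ≤ C) := by
  refine ⟨fun ε hε => ?_, fun θ₁ θ₂ v _ hv => ?_⟩
  -- With `d = min ρ₀ ε / 3`, both `d < ρ₀` and the loss `2d < ε` hold.
  · have hd : 0 < min ρ₀ ε := lt_min hρ₀ hε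
    have h1 : min ρ₀ ε / 3 < ρ₀ := by linarith [min_le_left ρ₀ ε]
    have h2 : 2 * (min ρ₀ ε / 3) < ε := by linarith [min_le_right ρ₀ ε]
    have h0 : 0 < min ρ₀ ε / 3 := by positivity
    exact ⟨_, h0, h1, fun α v hv => ⟨hv.sSup_ray_lt h0 h1 h2, hv.sInf_ray_gt h0 h1 h2⟩⟩
  · obtain ⟨A, hA⟩ := hv.exists_le_on_sector hρ₀
    obtain ⟨B, hB⟩ := hv.neg.exists_le_on_sector hρ₀
    refine ⟨max A B, fun ρ hρ θ hθ => abs_le'.2 ⟨?_, ?_⟩⟩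
    · exact (hA ρ hρ θ hθ).trans (le_max_left _ _)
    · exact (hB ρ hρ θ hθ).trans (le_max_right _ _)
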